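/- Let $K$ be a field and let $q\in K$ satisfy $q\neq 0$ and $q^m\neq 1$ for all integers $m\ge 1$ (for example $K=\mathbb{R}$ or $\mathbb{C}$ with $0<|q|<1$, or $q$ an indeterminate over $\mathbb{Q}$). For $n,k\in\mathbb{N}$ with $k\le n$ put $$(x;q)_n=\prod_{j=0}^{n-1}(1-q^jx),\qquad \begin{bmatrix} n\\ k\end{bmatrix}_q=\frac{\prod_{j=0}^{k-1}(1-q^{n-j})}{\prod_{j=0}^{k-1}(1-q^{k-j})},$$ and, for $s\in K$, $$F(n,s,q)=\frac{\sum_{j=0}^n(-s)^j\begin{bmatrix} n\\ j\end{bmatrix}_q}{(q;q^2)_{\lfloor (n+1)/2\rfloor}}.$$ Then for all $n\ge 0$ and all $s\in K$ the Hankel determinants $$D_0(n,s,q)=\det\bigl(F(2i+2j,s,q)\bigr)_{i,j=0}^n,\qquad D_1(n,s,q)=\det\bigl(F(2i+2j+1,s,q)\bigr)_{i,j=0}^n$$ satisfy $$D_0(n,s,q)=D_0(n,0,q)\prod_{j=0}^n\left((s-q^{2j})(s-q^{2j+1})\left(s-\frac1{q^{2j}}\right)\left(s-\frac1{q^{2j+1}}\right)\right)^{n-j}$$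 and $$D_1(n,s,q)=D_1(n,0,q)\,(1-s)^{n+1}\prod_{j=0}^n\left((s-q^{2j+2})(s-q^{2j+1})\left(s-\frac1{q^{2j+2}}\right)\left(s-\frac1{q^{2j+1}}\right)\right)^{n-j}.$$ -/

import Mathlib

namespace RogersSzego

/-- The `q`-Pochhammer symbol `(x; q)_n = ∏_{j=0}^{n-1} (1 - q^j x)`. -/
def qPoch {K : Type*} [Field K] (x q : K) (n : ℕ) : K :=
  ∏ j ∈ Finset.range n, (1 - q ^ j * x)

/-- The `q`-binomial coefficient
`∏_{j=0}^{k-1} (1 - q^(n-j)) / ∏_{j=0}^{k-1} (1 - q^(k-j))`.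
For `k > n` the factor `j = n` of the numerator is `1 - q^0 = 0`, so the value is `0`. -/
def qBinom {K : Type*} [Field K] (q : K) (n k : ℕ) : K :=
  (∏ j ∈ Finset.range k, (1 - q ^ (n - j))) / ∏ j ∈ Finset.range k, (1 - q ^ (k - j))

/-- The Rogers-Szegö polynomial `r_n(s, q) = ∑_{j=0}^n [n choose j]_q s^j`. -/
def rogersSzego {K : Type*} [Field K] (n : ℕ) (s q : K) : K :=
  ∑ j ∈ Finset.range (n + 1), qBinom q n j * s ^ j

/-- The normalized Rogers-Szegö polynomial
`F(n, s, q) = (∑_{j=0}^n (-s)^j [n choose j]_q) / (q; q^2)_{⌊(n+1)/2⌋}`. -/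
def F {K : Type*} [Field K] (n : ℕ) (s q : K) : K :=
  rogersSzego n (-s) q / qPoch q (q ^ 2) ((n + 1) / 2)

/-- `D_0(n, s, q) = det (F(2i+2j, s, q))_{i,j=0}^n`. -/
def D₀ {K : Type*} [Field K] (n : ℕ) (s q : K) : K :=
  Matrix.det (Matrix.of fun i j : Fin (n + 1) => F (2 * (i : ℕ) + 2 * (j : ℕ)) s q)

/-- `D_1(n, s, q) = det (F(2i+2j+1, s, q))_{i,j=0}^n`. -/
def D₁ {K : Type*} [Field K] (n : ℕ) (s q : K) : K :=
  Matrix.det (Matrix.of fun i j : Fin (n + 1) => F (2 * (i : ℕ) + 2 * (j : ℕ) + 1) s q)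

end RogersSzego

/-! With `p = q²` and `(t, u) = (1, q)`, respectively `(q², q)`, the sequences `F(2n)` and
`F(2n + 1)` are the moments of functionals `L` satisfying a first order `p`-difference (Pearson)
equation: `L (g) = 0` whenever `X g = (X - 1) (X - s²) f - (t X - s) (u X - s) f(p X)`.
Put `φᵢᵗ = ∏_{l < i} (t pˡ X - s)`. Since `(t X - s) φᵢᵗ(p X) = φᵢ₊₁ᵗ`, the choice `f = φᵢᵗ φⱼᵘ`
makes `g` equal to `φᵢᵗ φⱼᵘ` times a linear polynomial, which evaluates `L (φᵢᵗ φⱼᵘ)` recursively.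
The matrix `L (φᵢᵗ φⱼᵘ)`, whose determinant is the Hankel determinant up to leading coefficients,
is thereby the Hankel matrix for `s = 0` multiplied on both sides by explicit diagonal matrices,
up to a scalar. -/

namespace RogersSzego

open Polynomial

section CommRing

variable {R : Type*} [CommRing R]

lemma linearMap_mul_eq_sum_coeff (L : R[X] →ₗ[R] R) {N : ℕ} {f g : R[X]}
    (hf : f.natDegree < N) (hg : g.natDegree < N) :
    L (f * g) = ∑ a : Fin N, ∑ b : Fin N, f.coeff a * L (X ^ (a + b : ℕ)) * g.coeff b := by
  conv_lhs => rw [f.as_sum_range_C_mul_X_pow' hf, g.as_sum_range_C_mul_X_pow' hg]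
  simp only [Finset.sum_mul_sum, map_sum, Finset.sum_range]
  refine Finset.sum_congr rfl fun a _ => Finset.sum_congr rfl fun b _ => ?_
  rw [mul_mul_mul_comm, ← C_mul, ← pow_add, ← smul_eq_C_mul, map_smul, smul_eq_mul, mul_right_comm]

lemma det_coeff_eq_prod {N : ℕ} {f : ℕ → R[X]} (hf : ∀ i, (f i).natDegree ≤ i) :
    (Matrix.of fun a i : Fin N => (f i).coeff a).det = ∏ i ∈ Finset.range N, (f i).coeff i := by
  rw [Matrix.det_of_isUpperTriangular
    (Matrix.matrixOfPolynomials_blockTriangular (fun i : Fin N => f i) fun i => hf i),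
    Finset.prod_range]
  rfl

lemma det_linearMap_mul_of_natDegree_le (L : R[X] →ₗ[R] R) (N : ℕ) {f g : ℕ → R[X]}
    (hf : ∀ i, (f i).natDegree ≤ i) (hg : ∀ i, (g i).natDegree ≤ i) :
    (Matrix.of fun i j : Fin N => L (f i * g j)).det =
      (∏ i ∈ Finset.range N, (f i).coeff i) * (∏ i ∈ Finset.range N, (g i).coeff i) *
        (Matrix.of fun i j : Fin N => L (X ^ (i + j : ℕ))).det := by
  have congruence : (Matrix.of fun i j : Fin N => L (f i * g j)) =
      (Matrix.of fun a i : Fin N => (f i).coeff a).transpose *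
        (Matrix.of fun a b : Fin N => L (X ^ (a + b : ℕ))) *
        (Matrix.of fun b j : Fin N => (g j).coeff b) := by
    ext i j
    simp only [Matrix.of_apply, Matrix.mul_apply, Matrix.transpose_apply, Finset.sum_mul]
    rw [linearMap_mul_eq_sum_coeff L ((hf i).trans_lt i.2) ((hg j).trans_lt j.2), Finset.sum_comm]
  rw [congruence, Matrix.det_mul, Matrix.det_mul, Matrix.det_transpose, det_coeff_eq_prod hf,
    det_coeff_eq_prod hg]
  ring

/-- The linear functional on polynomials with moments `m`. -/
noncomputable def momentFunctional (m : ℕ → R) : R[X] →ₗ[R] R :=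
  (basisMonomials R).constr R m

lemma momentFunctional_X_pow (m : ℕ → R) (n : ℕ) : momentFunctional m (X ^ n) = m n := by
  rw [← monomial_one_right_eq_X_pow, momentFunctional]
  simpa only [coe_basisMonomials] using (basisMonomials R).constr_basis R m n

lemma momentFunctional_C_mul (m : ℕ → R) (a : R) (f : R[X]) :
    momentFunctional m (C a * f) = a * momentFunctional m f := by
  rw [← smul_eq_C_mul, map_smul, smul_eq_mul]

lemma momentFunctional_X_mul (m : ℕ → R) (f : R[X]) :
    momentFunctional m (X * f) = momentFunctional (fun n => m (n + 1)) f := by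
  induction f using Polynomial.induction_on' with
  | add f g hf hg => rw [mul_add, map_add, map_add, hf, hg]
  | monomial n a =>
    rw [← C_mul_X_pow_eq_monomial, mul_left_comm, ← pow_succ', momentFunctional_C_mul,
      momentFunctional_C_mul, momentFunctional_X_pow, momentFunctional_X_pow]

/-- The polynomial `∏_{l < k} (t pˡ X - s)`, a homogeneous form of the `p`-shifted factorial
`(t X / s; p)_k`. -/
noncomputable def shiftedFactorial (p s t : R) (k : ℕ) : R[X] :=
  ∏ l ∈ Finset.range k, (C (t * p ^ l) * X - C s)

lemma shiftedFactorial_succ (p s t : R) (k : ℕ) :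
    shiftedFactorial p s t (k + 1) = shiftedFactorial p s t k * (C (t * p ^ k) * X - C s) :=
  Finset.prod_range_succ _ _

lemma natDegree_shiftedFactorial_le (p s t : R) (k : ℕ) :
    (shiftedFactorial p s t k).natDegree ≤ k := by
  have h := (natDegree_prod_le (Finset.range k) fun l => C (t * p ^ l) * X - C s).trans
    (Finset.sum_le_card_nsmul _ _ 1 fun l _ => by compute_degree)
  rwa [Finset.card_range, smul_eq_mul, mul_one] at h

lemma coeff_shiftedFactorial_self (p s t : R) (k : ℕ) :
    (shiftedFactorial p s t k).coeff k = ∏ l ∈ Finset.range k, t * p ^ l := by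
  have h := coeff_prod_of_natDegree_le (s := Finset.range k)
    (fun l => C (t * p ^ l) * X - C s) 1 fun l _ => by compute_degree
  simpa only [shiftedFactorial, Finset.card_range, mul_one, coeff_sub, coeff_C_mul, coeff_X_one,
    coeff_C_succ, sub_zero] using h

lemma mul_shiftedFactorial_comp (p s t : R) (k : ℕ) :
    (C t * X - C s) * (shiftedFactorial p s t k).comp (C p * X) =
      shiftedFactorial p s t (k + 1) := by
  rw [shiftedFactorial, shiftedFactorial, Finset.prod_range_succ', prod_comp, mul_comm]
  congr 1
  · refine Finset.prod_congr rfl fun l _ => ?_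
    rw [sub_comp, mul_comp, C_comp, C_comp, X_comp, ← mul_assoc, ← C_mul, mul_assoc t, ← pow_succ]
  · simp

/-- A sequence `m` is the moment sequence of a functional `L` satisfying the `p`-Pearson equation
`L (((X - 1) (X - s²) f - (t X - s) (u X - s) f(p X)) / X) = 0`, here evaluated at `f = Xⁿ`.
At `n = 0` the truncated index `n - 1` is harmless, since its coefficient vanishes. -/
def IsPearsonMoment (p s t u : R) (m : ℕ → R) : Prop :=
  ∀ n, (1 - t * u * p ^ n) * m (n + 1) =
    (1 + s ^ 2 - s * (t + u) * p ^ n) * m n - s ^ 2 * (1 - p ^ n) * m (n - 1)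

namespace IsPearsonMoment

variable {p s t u : R} {m : ℕ → R}

lemma symm (h : IsPearsonMoment p s t u m) : IsPearsonMoment p s u t m := fun n => by
  rw [mul_comm u t, add_comm u t]
  exact h n

lemma momentFunctional_pred_eq (h : IsPearsonMoment p s t u m) (f : R[X]) :
    momentFunctional (fun n => m (n - 1)) ((X - 1) * (X - C (s ^ 2)) * f) =
      momentFunctional (fun n => m (n - 1))
        ((C t * X - C s) * (C u * X - C s) * f.comp (C p * X)) := by
  induction f using Polynomial.induction_on' with
  | add f g hf hg => rw [add_comp, mul_add, mul_add, map_add, map_add, hf, hg]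
  | monomial n a =>
    have expand : (X - 1) * (X - C (s ^ 2)) * monomial n a -
          (C t * X - C s) * (C u * X - C s) * (monomial n a).comp (C p * X) =
        C (a * (1 - t * u * p ^ n)) * X ^ (n + 1 + 1)
          - C (a * (1 + s ^ 2 - s * (t + u) * p ^ n)) * X ^ (n + 1)
          + C (a * (s ^ 2 * (1 - p ^ n))) * X ^ n := by
      rw [← C_mul_X_pow_eq_monomial]
      simp only [mul_comp, C_comp, X_pow_comp, C_mul, C_sub, C_add, C_pow, C_1]
      ring
    rw [← sub_eq_zero, ← map_sub, expand]
    simp only [map_add, map_sub, momentFunctional_C_mul, momentFunctional_X_pow,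
      Nat.add_sub_cancel]
    linear_combination a * h n

lemma momentFunctional_eq_zero (h : IsPearsonMoment p s t u m) {f g : R[X]}
    (hg : X * g = (X - 1) * (X - C (s ^ 2)) * f -
      (C t * X - C s) * (C u * X - C s) * f.comp (C p * X)) :
    momentFunctional m g = 0 := by
  have hX := momentFunctional_X_mul (fun n => m (n - 1)) g
  rwa [hg, map_sub, h.momentFunctional_pred_eq, sub_self, eq_comm] at hX

lemma momentFunctional_shiftedFactorial_succ_mul (h : IsPearsonMoment p s t u m) (i j : ℕ) :
    (1 - t * u * p ^ (i + j)) *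
        momentFunctional m (shiftedFactorial p s t (i + 1) * shiftedFactorial p s u j) =
      (s - t * p ^ i) * (s * (t * p ^ i) - 1) *
        momentFunctional m (shiftedFactorial p s t i * shiftedFactorial p s u j) := by
  set φ := shiftedFactorial p s t i
  set ψ := shiftedFactorial p s u j
  set T := t * p ^ i with hT
  set U := u * p ^ j with hU
  have hTU : t * u * p ^ (i + j) = T * U := by rw [hT, hU]; ring
  -- `(X - 1) (X - s²) - (T X - s) (U X - s)` is divisible by `X`.
  have pearson : momentFunctional m
      (C (1 - T * U) * (X * (φ * ψ)) - C (1 + s ^ 2 - s * (T + U)) * (φ * ψ)) = 0 := by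
    refine h.momentFunctional_eq_zero (f := φ * ψ) ?_
    rw [mul_comp, mul_mul_mul_comm (C t * X - C s), mul_shiftedFactorial_comp,
      mul_shiftedFactorial_comp, shiftedFactorial_succ, shiftedFactorial_succ]
    simp only [C_mul, C_sub, C_add, C_pow, C_1, hT, hU]
    ring
  have succ_mul : shiftedFactorial p s t (i + 1) * ψ = C T * (X * (φ * ψ)) - C s * (φ * ψ) := by
    rw [shiftedFactorial_succ]
    ring
  rw [map_sub, momentFunctional_C_mul, momentFunctional_C_mul] at pearson
  rw [hTU, succ_mul, map_sub, momentFunctional_C_mul, momentFunctional_C_mul]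
  linear_combination T * pearson

lemma momentFunctional_shiftedFactorial_mul [IsDomain R] {m₀ : ℕ → R} {c : R}
    (h : IsPearsonMoment p s t u m) (h₀ : IsPearsonMoment p 0 t u m₀) (hm : m 0 = c * m₀ 0)
    (htu : ∀ n, 1 - t * u * p ^ n ≠ 0) (i j : ℕ) :
    momentFunctional m (shiftedFactorial p s t i * shiftedFactorial p s u j) =
      c * (∏ l ∈ Finset.range i, (s - t * p ^ l) * (s * (t * p ^ l) - 1)) *
        (∏ l ∈ Finset.range j, (s - u * p ^ l) * (s * (u * p ^ l) - 1)) * m₀ (i + j) := by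
  have m₀_succ (n : ℕ) : (1 - t * u * p ^ n) * m₀ (n + 1) = m₀ n := by linear_combination h₀ n
  induction j with
  | zero =>
    induction i with
    | zero => simpa [shiftedFactorial, hm] using momentFunctional_X_pow m 0
    | succ i ih =>
      refine mul_left_cancel₀ (htu (i + 0)) ?_
      rw [h.momentFunctional_shiftedFactorial_succ_mul, ih, Finset.prod_range_succ,
        ← m₀_succ (i + 0), add_right_comm]
      ring
  | succ j ih =>
    have succ_right := h.symm.momentFunctional_shiftedFactorial_succ_mul j i
    rw [mul_comm u t, add_comm j i, mul_comm (shiftedFactorial p s u _),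
      mul_comm (shiftedFactorial p s u _)] at succ_right
    refine mul_left_cancel₀ (htu (i + j)) ?_
    rw [succ_right, ih, Finset.prod_range_succ, ← m₀_succ (i + j), add_assoc]
    ring

end IsPearsonMoment

end CommRing

lemma prod_range_prod_range {M : Type*} [CommMonoid M] (a : ℕ → M) (n : ℕ) :
    ∏ i ∈ Finset.range (n + 1), ∏ l ∈ Finset.range i, a l =
      ∏ l ∈ Finset.range (n + 1), a l ^ (n - l) := by
  rw [Finset.prod_comm' (t' := Finset.range (n + 1)) (s' := fun l => Finset.Ioc l n)
    (by simp only [Finset.mem_range, Finset.mem_Ioc]; omega)]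
  simp only [Finset.prod_const, Nat.card_Ioc]

lemma IsPearsonMoment.det_hankel_mul {R : Type*} [CommRing R] [IsDomain R] {p s t u c : R}
    {m m₀ : ℕ → R} (h : IsPearsonMoment p s t u m) (h₀ : IsPearsonMoment p 0 t u m₀)
    (hm : m 0 = c * m₀ 0) (htu : ∀ n, 1 - t * u * p ^ n ≠ 0) (n : ℕ) :
    (∏ l ∈ Finset.range (n + 1), (t * p ^ l * (u * p ^ l)) ^ (n - l)) *
        (Matrix.of fun i j : Fin (n + 1) => m (i + j)).det =
      (Matrix.of fun i j : Fin (n + 1) => m₀ (i + j)).det * c ^ (n + 1) *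
        ∏ l ∈ Finset.range (n + 1), (((s - t * p ^ l) * (s * (t * p ^ l) - 1)) *
          ((s - u * p ^ l) * (s * (u * p ^ l) - 1))) ^ (n - l) := by
  have change_of_basis := det_linearMap_mul_of_natDegree_le (momentFunctional m) (n + 1)
    (natDegree_shiftedFactorial_le p s t) (natDegree_shiftedFactorial_le p s u)
  simp only [coeff_shiftedFactorial_self, prod_range_prod_range, momentFunctional_X_pow]
    at change_of_basis
  set a : R → ℕ → R := fun v i => ∏ l ∈ Finset.range i, (s - v * p ^ l) * (s * (v * p ^ l) - 1)
  have factor : (Matrix.of fun i j : Fin (n + 1) =>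
        momentFunctional m (shiftedFactorial p s t i * shiftedFactorial p s u j)) =
      c • (Matrix.diagonal (fun i : Fin (n + 1) => a t i) *
        (Matrix.of fun i j : Fin (n + 1) => m₀ (i + j)) *
        Matrix.diagonal (fun j : Fin (n + 1) => a u j)) := by
    ext i j
    rw [Matrix.smul_apply, Matrix.mul_diagonal, Matrix.diagonal_mul, Matrix.of_apply,
      Matrix.of_apply, h.momentFunctional_shiftedFactorial_mul h₀ hm htu, smul_eq_mul]
    ring
  have det_diagonal (v : R) : (Matrix.diagonal fun i : Fin (n + 1) => a v i).det =
      ∏ l ∈ Finset.range (n + 1), ((s - v * p ^ l) * (s * (v * p ^ l) - 1)) ^ (n - l) := by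
    rw [Matrix.det_diagonal, ← Finset.prod_range (a v), prod_range_prod_range]
  rw [factor, Matrix.det_smul, Fintype.card_fin, Matrix.det_mul, Matrix.det_mul, det_diagonal,
    det_diagonal] at change_of_basis
  simp only [mul_pow, Finset.prod_mul_distrib] at change_of_basis ⊢
  linear_combination -change_of_basis

lemma IsPearsonMoment.det_hankel {K : Type*} [Field K] {p s t u c : K} {m m₀ : ℕ → K}
    (h : IsPearsonMoment p s t u m) (h₀ : IsPearsonMoment p 0 t u m₀) (hm : m 0 = c * m₀ 0)
    (htu : ∀ n, 1 - t * u * p ^ n ≠ 0) (hp : p ≠ 0) (ht : t ≠ 0) (hu : u ≠ 0) (n : ℕ) :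
    (Matrix.of fun i j : Fin (n + 1) => m (i + j)).det =
      (Matrix.of fun i j : Fin (n + 1) => m₀ (i + j)).det * c ^ (n + 1) *
        ∏ l ∈ Finset.range (n + 1), ((s - t * p ^ l) * (s - u * p ^ l) *
          (s - 1 / (t * p ^ l)) * (s - 1 / (u * p ^ l))) ^ (n - l) := by
  have tp_ne (l : ℕ) : t * p ^ l ≠ 0 := mul_ne_zero ht (pow_ne_zero l hp)
  have up_ne (l : ℕ) : u * p ^ l ≠ 0 := mul_ne_zero hu (pow_ne_zero l hp)
  have leading_ne : ∏ l ∈ Finset.range (n + 1), (t * p ^ l * (u * p ^ l)) ^ (n - l) ≠ 0 :=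
    Finset.prod_ne_zero_iff.2 fun l _ => pow_ne_zero _ (mul_ne_zero (tp_ne l) (up_ne l))
  refine mul_left_cancel₀ leading_ne ?_
  rw [h.det_hankel_mul h₀ hm htu, mul_left_comm, ← Finset.prod_mul_distrib]
  congr 1
  refine Finset.prod_congr rfl fun l _ => ?_
  rw [← mul_pow]
  congr 1
  have := tp_ne l
  have := up_ne l
  field_simp

variable {K : Type*} [Field K] {q : K}

lemma one_sub_pow_ne_zero (hq : ∀ m : ℕ, 0 < m → q ^ m ≠ 1) {m : ℕ} (hm : 0 < m) :
    1 - q ^ m ≠ 0 :=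
  sub_ne_zero.2 (hq m hm).symm

lemma qBinom_zero_right (q : K) (n : ℕ) : qBinom q n 0 = 1 := by
  simp [qBinom]

lemma qBinom_eq_zero (q : K) {n k : ℕ} (h : n < k) : qBinom q n k = 0 := by
  rw [qBinom, Finset.prod_eq_zero (Finset.mem_range.2 h) (by simp), zero_div]

lemma one_sub_mul_qBinom_succ_succ (hq : ∀ m : ℕ, 0 < m → q ^ m ≠ 1) (n k : ℕ) :
    (1 - q ^ (k + 1)) * qBinom q (n + 1) (k + 1) = (1 - q ^ (n + 1)) * qBinom q n k := by
  have hk := one_sub_pow_ne_zero hq k.succ_pos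
  simp only [qBinom, Finset.prod_range_succ', Nat.add_sub_add_right, Nat.sub_zero]
  rw [mul_div_mul_comm]
  field_simp

lemma one_sub_mul_qBinom_succ_right (hq : ∀ m : ℕ, 0 < m → q ^ m ≠ 1) (n k : ℕ) :
    (1 - q ^ (k + 1)) * qBinom q n (k + 1) = (1 - q ^ (n - k)) * qBinom q n k := by
  have hk := one_sub_pow_ne_zero hq k.succ_pos
  have denominator : ∏ j ∈ Finset.range (k + 1), (1 - q ^ (k + 1 - j)) =
      (∏ j ∈ Finset.range k, (1 - q ^ (k - j))) * (1 - q ^ (k + 1)) := by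
    simp [Finset.prod_range_succ']
  rw [qBinom, qBinom, denominator, Finset.prod_range_succ, mul_div_mul_comm]
  field_simp

lemma qBinom_succ_succ (hq : ∀ m : ℕ, 0 < m → q ^ m ≠ 1) (n k : ℕ) :
    qBinom q (n + 1) (k + 1) = qBinom q n k + q ^ (k + 1) * qBinom q n (k + 1) := by
  rcases lt_or_ge n k with hnk | hkn
  · rw [qBinom_eq_zero q hnk, qBinom_eq_zero q (hnk.trans k.lt_succ_self),
      qBinom_eq_zero q (Nat.succ_lt_succ hnk)]
    ring
  · obtain ⟨d, rfl⟩ := Nat.exists_eq_add_of_le hkn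
    have succ_right := one_sub_mul_qBinom_succ_right hq (k + d) k
    rw [Nat.add_sub_cancel_left] at succ_right
    have hk : 1 - q ^ (k + 1) ≠ 0 := one_sub_pow_ne_zero hq k.succ_pos
    refine mul_left_cancel₀ hk ?_
    linear_combination one_sub_mul_qBinom_succ_succ hq (k + d) k - q ^ (k + 1) * succ_right

lemma rogersSzego_eq_sum_range (q x : K) {n N : ℕ} (h : n < N) :
    rogersSzego n x q = ∑ k ∈ Finset.range N, qBinom q n k * x ^ k := by
  refine Finset.sum_subset (Finset.range_subset_range.2 h) fun k _ hk => ?_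
  rw [qBinom_eq_zero q (by simpa using hk), zero_mul]

lemma rogersSzego_eq_one_add_sum_range (q x : K) {n N : ℕ} (h : n ≤ N) :
    rogersSzego n x q = 1 + ∑ k ∈ Finset.range N, qBinom q n (k + 1) * x ^ (k + 1) := by
  rw [rogersSzego_eq_sum_range q x (Nat.lt_succ_of_le h), Finset.sum_range_succ',
    qBinom_zero_right, pow_zero, mul_one, add_comm]

lemma rogersSzego_zero (x q : K) : rogersSzego 0 x q = 1 := by
  simp [rogersSzego, qBinom_zero_right]

lemma rogersSzego_one (hq : ∀ m : ℕ, 0 < m → q ^ m ≠ 1) (x : K) :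
    rogersSzego 1 x q = 1 + x := by
  have h := one_sub_pow_ne_zero hq one_pos
  rw [pow_one] at h
  simp [rogersSzego, Finset.sum_range_succ, qBinom, div_self h]

lemma rogersSzego_add_two (hq : ∀ m : ℕ, 0 < m → q ^ m ≠ 1) (n : ℕ) (x : K) :
    rogersSzego (n + 2) x q =
      (1 + x) * rogersSzego (n + 1) x q - x * (1 - q ^ (n + 1)) * rogersSzego n x q := by
  rw [one_add_mul, rogersSzego_eq_one_add_sum_range q x le_rfl]
  nth_rewrite 1 [rogersSzego_eq_one_add_sum_range q x (n + 1).le_succ]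
  rw [rogersSzego_eq_sum_range q x (n + 1).lt_succ_self,
    rogersSzego_eq_sum_range q x (n.lt_succ_self.trans (n + 1).lt_succ_self), add_assoc,
    add_sub_assoc, Finset.mul_sum, Finset.mul_sum, ← Finset.sum_add_distrib,
    ← Finset.sum_sub_distrib]
  congr 1
  refine Finset.sum_congr rfl fun k _ => ?_
  rw [qBinom_succ_succ hq (n + 1) k]
  linear_combination (-x ^ (k + 1)) * one_sub_mul_qBinom_succ_succ hq n k

/-- For `n < 2` the truncated index `n - 2` is harmless, since its coefficient contains a factor
`1 - q ^ 0`. -/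
lemma rogersSzego_neg_add_two (hq : ∀ m : ℕ, 0 < m → q ^ m ≠ 1) (n : ℕ) (s : K) :
    rogersSzego (n + 2) (-s) q =
      (1 + s ^ 2 - s * (1 + q) * q ^ n) * rogersSzego n (-s) q -
        s ^ 2 * (1 - q ^ n) * (1 - q ^ (n - 1)) * rogersSzego (n - 2) (-s) q := by
  match n with
  | 0 =>
    linear_combination rogersSzego_add_two hq 0 (-s) + (1 - s) * rogersSzego_one hq (-s) -
      (1 - s) ^ 2 * rogersSzego_zero (-s) q
  | 1 =>
    linear_combination rogersSzego_add_two hq 1 (-s) +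
      (1 - s) * rogersSzego_add_two hq 0 (-s) -
      s * (1 - q) * (rogersSzego_one hq (-s) - (1 - s) * rogersSzego_zero (-s) q)
  | n + 2 =>
    rw [Nat.add_sub_cancel, show n + 2 - 1 = n + 1 from rfl]
    linear_combination rogersSzego_add_two hq (n + 2) (-s) +
      (1 - s) * rogersSzego_add_two hq (n + 1) (-s) -
      s * (1 - q ^ (n + 2)) * rogersSzego_add_two hq n (-s)

lemma qPoch_succ (x q : K) (n : ℕ) : qPoch x q (n + 1) = qPoch x q n * (1 - q ^ n * x) :=
  Finset.prod_range_succ _ _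

lemma one_sub_mul_div_qPoch_succ (hq : ∀ m : ℕ, 0 < m → q ^ m ≠ 1) (n : ℕ) (x : K) :
    (1 - q ^ (2 * n + 1)) * (x / qPoch q (q ^ 2) (n + 1)) = x / qPoch q (q ^ 2) n := by
  rw [qPoch_succ, ← pow_mul, ← pow_succ, mul_comm (qPoch _ _ _), ← mul_div_assoc,
    mul_div_mul_left _ _ (one_sub_pow_ne_zero hq (2 * n).succ_pos)]

lemma F_even (n : ℕ) (s q : K) :
    F (2 * n) s q = rogersSzego (2 * n) (-s) q / qPoch q (q ^ 2) n := by
  rw [F, show (2 * n + 1) / 2 = n by omega]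

lemma F_odd (n : ℕ) (s q : K) :
    F (2 * n + 1) s q = rogersSzego (2 * n + 1) (-s) q / qPoch q (q ^ 2) (n + 1) := by
  rw [F, show (2 * n + 1 + 1) / 2 = n + 1 by omega]

lemma F_zero (s q : K) : F 0 s q = 1 := by
  simp [F, rogersSzego_zero, qPoch]

lemma F_one (hq : ∀ m : ℕ, 0 < m → q ^ m ≠ 1) (s : K) : F 1 s q = (1 - s) / (1 - q) := by
  simp [F, rogersSzego_one hq, qPoch, sub_eq_add_neg]

lemma isPearsonMoment_F_even (hq : ∀ m : ℕ, 0 < m → q ^ m ≠ 1) (s : K) :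
    IsPearsonMoment (q ^ 2) s 1 q (fun n => F (2 * n) s q) := fun n => by
  have recurrence := rogersSzego_neg_add_two hq (2 * n) s
  have succ := one_sub_mul_div_qPoch_succ hq n (rogersSzego (2 * n + 2) (-s) q)
  have pred : (1 - q ^ (2 * n)) * F (2 * (n - 1)) s q = (1 - q ^ (2 * n)) *
      (1 - q ^ (2 * n - 1)) * (rogersSzego (2 * n - 2) (-s) q / qPoch q (q ^ 2) n) := by
    cases n with
    | zero => simp
    | succ k =>
      rw [Nat.add_sub_cancel, F_even, ← one_sub_mul_div_qPoch_succ hq k, mul_assoc]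
      rfl
  beta_reduce
  rw [F_even, F_even, mul_add_one]
  linear_combination succ + (qPoch q (q ^ 2) n)⁻¹ * recurrence + s ^ 2 * pred

lemma isPearsonMoment_F_odd (hq : ∀ m : ℕ, 0 < m → q ^ m ≠ 1) (s : K) :
    IsPearsonMoment (q ^ 2) s (q ^ 2) q (fun n => F (2 * n + 1) s q) := fun n => by
  have recurrence := rogersSzego_neg_add_two hq (2 * n + 1) s
  have succ := one_sub_mul_div_qPoch_succ hq (n + 1) (rogersSzego (2 * n + 1 + 2) (-s) q)
  have pred : (1 - q ^ (2 * n)) * F (2 * (n - 1) + 1) s q = (1 - q ^ (2 * n)) *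
      ((1 - q ^ (2 * n + 1)) *
        (rogersSzego (2 * n - 1) (-s) q / qPoch q (q ^ 2) (n + 1))) := by
    rw [one_sub_mul_div_qPoch_succ hq]
    cases n with
    | zero => simp
    | succ k =>
      rw [Nat.add_sub_cancel, F_odd]
      rfl
  beta_reduce
  rw [F_odd, F_odd, mul_add_one, add_right_comm]
  rw [Nat.add_sub_cancel, show 2 * n + 1 - 2 = 2 * n - 1 from rfl] at recurrence
  linear_combination succ + (qPoch q (q ^ 2) (n + 1))⁻¹ * recurrence + s ^ 2 * pred

end RogersSzego

theorem theorem3p2 {K : Type*} [Field K] (q : K) (hq0 : q ≠ 0)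
    (hq : ∀ m : ℕ, 0 < m → q ^ m ≠ 1) (n : ℕ) (s : K) :
    RogersSzego.D₀ n s q = RogersSzego.D₀ n 0 q *
        ∏ j ∈ Finset.range (n + 1),
          ((s - q ^ (2 * j)) * (s - q ^ (2 * j + 1)) *
            (s - 1 / q ^ (2 * j)) * (s - 1 / q ^ (2 * j + 1))) ^ (n - j) ∧
    RogersSzego.D₁ n s q = RogersSzego.D₁ n 0 q * (1 - s) ^ (n + 1) *
        ∏ j ∈ Finset.range (n + 1),
          ((s - q ^ (2 * j + 2)) * (s - q ^ (2 * j + 1)) *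
            (s - 1 / q ^ (2 * j + 2)) * (s - 1 / q ^ (2 * j + 1))) ^ (n - j) := by
  have hp : q ^ 2 ≠ 0 := pow_ne_zero 2 hq0
  have one_mul_pow (l : ℕ) : 1 * (q ^ 2) ^ l = q ^ (2 * l) := by ring
  have sq_mul_pow (l : ℕ) : q ^ 2 * (q ^ 2) ^ l = q ^ (2 * l + 2) := by ring
  have self_mul_pow (l : ℕ) : q * (q ^ 2) ^ l = q ^ (2 * l + 1) := by ring
  constructor
  · have h := (RogersSzego.isPearsonMoment_F_even hq s).det_hankel
      (RogersSzego.isPearsonMoment_F_even hq 0) (c := 1) (by simp [RogersSzego.F_zero])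
      (fun l => by
        rw [one_mul, self_mul_pow]
        exact RogersSzego.one_sub_pow_ne_zero hq (Nat.succ_pos _)) hp one_ne_zero hq0 n
    simpa only [RogersSzego.D₀, mul_add, one_pow, mul_one, one_mul_pow, self_mul_pow] using h
  · have h := (RogersSzego.isPearsonMoment_F_odd hq s).det_hankel
      (RogersSzego.isPearsonMoment_F_odd hq 0) (c := 1 - s)
      (by simp [RogersSzego.F_one hq, div_eq_mul_inv])
      (fun l => by
        rw [mul_assoc, self_mul_pow, ← pow_add]
        exact RogersSzego.one_sub_pow_ne_zero hq (by omega)) hp hp hq0 n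
    simpa only [RogersSzego.D₁, mul_add, sq_mul_pow, self_mul_pow] using h
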